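/- Let $M$ be a smooth manifold and let $(A,[\cdot,\cdot],\rho)$ be a Lie algebroid over $M$. Let $d$ be the differential of $A$ on $\Gamma(\bigwedge^\bullet A^*)$, given by the Koszul formula. Let $\pi\in\Gamma(\bigwedge^2A)$ be a Poisson bivector, i.e. $[\pi,\pi]_{SN}=0$ for the Schouten–Nijenhuis bracket, and let $\omega\in\Gamma(\bigwedge^2A^*)$ satisfy $d\omega=0$. Put $\pi^\sharp(\alpha)=\pi(\alpha,\cdot)$, $\omega^\flat(X)=\omega(X,\cdot)$, $N=\pi^\sharp\circ\omega^\flat$, ${}^tN\alpha=\alpha\circ N$, $\omega_N=\omega(N\cdot,\cdot)$ (which is a $2$-form) and $\psi=d\omega_N$. Let $[X,Y]_N=[NX,Y]+[X,NY]-N[X,Y]$ and $\rho_N=\rho\circ N$, and let $d_N$ be given by the Koszul formula with $[\cdot,\cdot]_N$ and $\rho_N$ in place of $[\cdot,\cdot]$ and $\rho$. Let $[\alpha,\beta]_\pi=\mathcal L_{\pi^\sharp\alpha}\beta-\mathcal L_{\pi^\sharp\beta}\alpha-d(\pi(\alpha,\beta))$, and let $([\cdot,\cdot]_N)_\pi$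 be given by the same formula with the Lie derivative and differential defined by $[\cdot,\cdot]_N$ and $\rho_N$. Then $(\pi,N,\psi)$ is a Poisson quasi-Nijenhuis structure (without background) on $A$, that is: 1. $\pi$ is a Poisson bivector, and $N\circ\pi^\sharp=\pi^\sharp\circ{}^tN$; 2. $C_{\pi,N}:=([\cdot,\cdot]_N)_\pi-([\cdot,\cdot]_\pi)_{{}^tN}=0$, where $([\alpha,\beta]_\pi)_{{}^tN}=[{}^tN\alpha,\beta]_\pi+[\alpha,{}^tN\beta]_\pi-{}^tN[\alpha,\beta]_\pi$; 3. for all $X,Y\in\Gamma(A)$, $$[NX,NY]-N\big([NX,Y]+[X,NY]-N[X,Y]\big)=\pi^\sharp(i_{X\wedge Y}\psi),$$ where $i_{X\wedge Y}=i_X\circ i_Y$, i.e. $(i_{X\wedge Y}\psi)(Z)=\psi(Y,X,Z)$; 4. $d\psi=0$ and $d_N\psi=0$. -/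

import Mathlib

open scoped Manifold ContDiff

noncomputable section

/-! ### Alternating tensors over a commutative ring of functions

Below, `R` plays the role of `C^∞(M)` and `L` that of the module `Γ(A)` of smooth sections of a
vector bundle `A → M`. Tensor fields are represented by `C^∞(M)`-multilinear maps on sections. -/

section Tensors

variable {R L : Type*} [CommRing R] [AddCommGroup L] [Module R L]

/-- Contraction of an alternating bilinear map with its first argument: `B♭ x = B(x, ·)`. -/
def flat (B : L [⋀^Fin 2]→ₗ[R] R) : L →ₗ[R] Module.Dual R L :=
  LinearMap.mk₂ R (fun x y => B ![x, y])
    (fun x x' y => B.map_vecCons_add ![y] x x')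
    (fun c x y => B.map_vecCons_smul ![y] c x)
    (fun x y y' => by
      have e : ∀ z, Function.update ![x, y] 1 z = ![x, z] := fun z => by
        funext i; fin_cases i <;> rfl
      simpa only [e] using B.map_update_add ![x, y] 1 y y')
    (fun c x y => by
      have e : ∀ z, Function.update ![x, y] 1 z = ![x, z] := fun z => by
        funext i; fin_cases i <;> rfl
      simpa only [e] using B.map_update_smul ![x, y] 1 c y)

@[simp] theorem flat_apply (B : L [⋀^Fin 2]→ₗ[R] R) (x y : L) : flat B x y = B ![x, y] := rfl

theorem alt_self (B : L [⋀^Fin 2]→ₗ[R] R) (x : L) : B ![x, x] = 0 :=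
  B.map_eq_zero_of_eq ![x, x] (i := 0) (j := 1) rfl (by decide)

theorem alt_swap (B : L [⋀^Fin 2]→ₗ[R] R) (x y : L) : B ![y, x] = -B ![x, y] := by
  have h := alt_self B (x + y)
  have h' : flat B (x + y) (x + y) = 0 := h
  simp only [map_add, LinearMap.add_apply, flat_apply, alt_self, zero_add, add_zero] at h'
  exact eq_neg_of_add_eq_zero_left h'

/-- The alternating map given by an alternating bilinear form. -/
def mkAlt2 (B : L →ₗ[R] Module.Dual R L) (h : ∀ x, B x x = 0) : L [⋀^Fin 2]→ₗ[R] R where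
  toFun v := B (v 0) (v 1)
  map_update_add' v i x y := by
    fin_cases i <;> simp
  map_update_smul' v i c x := by
    fin_cases i <;> simp
  map_eq_zero_of_eq' v i j hv hij := by
    fin_cases i <;> fin_cases j <;> simp_all

@[simp] theorem mkAlt2_apply (B : L →ₗ[R] Module.Dual R L) (h : ∀ x, B x x = 0) (x y : L) :
    mkAlt2 B h ![x, y] = B x y := rfl

/-- The alternating map given by a skew-symmetric trilinear function. -/
def mkAlt3 [Algebra ℝ R] (f : L → L → L → R) (hadd : ∀ x x' y z, f (x + x') y z = f x y z + f x' y z)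
    (hsmul : ∀ (c : R) x y z, f (c • x) y z = c * f x y z)
    (h12 : ∀ x y z, f y x z = -f x y z) (h23 : ∀ x y z, f x z y = -f x y z) :
    L [⋀^Fin 3]→ₗ[R] R where
  toFun v := f (v 0) (v 1) (v 2)
  map_update_add' {inst} v i x y := by
    obtain rfl := Subsingleton.elim inst (instDecidableEqFin 3)
    have hadd2 : ∀ x y y' z, f x (y + y') z = f x y z + f x y' z := fun x y y' z => by
      rw [h12, hadd, h12 x y, h12 x y']; ring
    have hadd3 : ∀ x y z z', f x y (z + z') = f x y z + f x y z' := fun x y z z' => by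
      rw [h23, hadd2, h23 x y z, h23 x y z']; ring
    fin_cases i <;> simp [hadd, hadd2, hadd3]
  map_update_smul' {inst} v i c x := by
    obtain rfl := Subsingleton.elim inst (instDecidableEqFin 3)
    have hsmul2 : ∀ (c : R) x y z, f x (c • y) z = c * f x y z := fun c x y z => by
      rw [h12, hsmul, h12 x y]; ring
    have hsmul3 : ∀ (c : R) x y z, f x y (c • z) = c * f x y z := fun c x y z => by
      rw [h23, hsmul2, h23 x y z]; ring
    fin_cases i <;> simp [hsmul, hsmul2, hsmul3]
  map_eq_zero_of_eq' v i j hv hij := by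
    have half : ∀ a : R, a = -a → a = 0 := fun a ha => by
      have h2 : (2 : ℝ) • a = 0 := by rw [two_smul]; nth_rewrite 1 [ha]; simp
      have h3 := congrArg (fun t => (2 : ℝ)⁻¹ • t) h2
      simpa [smul_smul] using h3
    have e12 : ∀ x z, f x x z = 0 := fun x z => half _ (h12 x x z)
    have e23 : ∀ x z, f x z z = 0 := fun x z => half _ (h23 x z z)
    have e13 : ∀ x z, f x z x = 0 := fun x z => by rw [h23, e12, neg_zero]
    fin_cases i <;> fin_cases j <;>
      first
      | exact absurd rfl hij
      | (simp only [Fin.zero_eta, Fin.mk_one, Fin.reduceFinMk] at hv; simp [hv, e12, e23, e13])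

@[simp] theorem mkAlt3_apply [Algebra ℝ R] (f : L → L → L → R) (hadd hsmul h12 h23) (x y z : L) :
    mkAlt3 (R := R) f hadd hsmul h12 h23 ![x, y, z] = f x y z := rfl

/-- The contraction of a `3`-form with `x ∧ y`, in the convention `i_{x ∧ y} = i_x ∘ i_y`, that is
`(i_{x ∧ y} ψ)(z) = ψ(y, x, z)`. -/
def contract₂ (ψ : L [⋀^Fin 3]→ₗ[R] R) (x y : L) : Module.Dual R L :=
  flat (ψ.curryLeft y) x

@[simp] theorem contract₂_apply (ψ : L [⋀^Fin 3]→ₗ[R] R) (x y z : L) :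
    contract₂ ψ x y z = ψ ![y, x, z] := rfl

/-- The transpose `ᵗN α = α ∘ N`. -/
def transp (N : Module.End R L) : Module.End R (Module.Dual R L) := Module.Dual.transpose N

@[simp] theorem transp_apply (N : Module.End R L) (α : Module.Dual R L) (x : L) :
    transp N α x = α (N x) := rfl

/-- The bivector `x ∧ y`, as an alternating map: `(x ∧ y)(α, β) = α(x) β(y) - α(y) β(x)`. -/
def wedge (x y : L) : Module.Dual R L [⋀^Fin 2]→ₗ[R] R :=
  mkAlt2 (LinearMap.mk₂ R (fun α β => α x * β y - α y * β x)
    (fun _ _ _ => by simp only [LinearMap.add_apply]; ring)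
    (fun _ _ _ => by simp only [LinearMap.smul_apply, smul_eq_mul]; ring)
    (fun _ _ _ => by simp only [LinearMap.add_apply]; ring)
    (fun _ _ _ => by simp only [LinearMap.smul_apply, smul_eq_mul]; ring))
    (fun α => by simp only [LinearMap.mk₂_apply]; ring)

/-- The trivector `x ∧ y ∧ z` evaluated on three `1`-forms. -/
def wedge3 (x y z : L) (α β γ : Module.Dual R L) : R :=
  α x * (β y * γ z - β z * γ y) - α y * (β x * γ z - β z * γ x) + α z * (β x * γ y - β y * γ x)

theorem wedge_apply (x y : L) (α β : Module.Dual R L) :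
    wedge x y ![α, β] = α x * β y - α y * β x := rfl

variable [Module.IsReflexive R L]

/-- For a bivector `π`, i.e. an alternating bilinear map on the dual, `π♯ α = π(α, ·)`, as an
element of the double dual `L** = L`. -/
def sharp (π : Module.Dual R L [⋀^Fin 2]→ₗ[R] R) : Module.Dual R L →ₗ[R] L :=
  (Module.evalEquiv R L).symm.toLinearMap ∘ₗ flat π

@[simp] theorem apply_sharp (π : Module.Dual R L [⋀^Fin 2]→ₗ[R] R) (α β : Module.Dual R L) :
    β (sharp π α) = π ![α, β] :=
  Module.apply_evalEquiv_symm_apply R L β (flat π α)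

theorem sharp_wedge (x y : L) (α : Module.Dual R L) :
    sharp (wedge x y) α = α x • y - α y • x := by
  apply (Module.evalEquiv R L).injective
  ext β
  simp [wedge_apply]

/-- The endomorphism `N = π♯ ∘ Ω♭`. -/
def recursion (π : Module.Dual R L [⋀^Fin 2]→ₗ[R] R) (Ω : L [⋀^Fin 2]→ₗ[R] R) :
    Module.End R L :=
  sharp π ∘ₗ flat Ω

/-- The `2`-form `Ω_N = Ω(N ·, ·)` for `N = π♯ ∘ Ω♭`. -/
def omegaN (π : Module.Dual R L [⋀^Fin 2]→ₗ[R] R) (Ω : L [⋀^Fin 2]→ₗ[R] R) :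
    L [⋀^Fin 2]→ₗ[R] R :=
  mkAlt2 (flat Ω ∘ₗ recursion π Ω) fun x => by
    have h : Ω ![x, recursion π Ω x] = 0 := by
      rw [← flat_apply]
      simp only [recursion, LinearMap.comp_apply, apply_sharp, alt_self]
    simp only [LinearMap.comp_apply, flat_apply]
    rw [alt_swap, h, neg_zero]

theorem omegaN_apply (π : Module.Dual R L [⋀^Fin 2]→ₗ[R] R) (Ω : L [⋀^Fin 2]→ₗ[R] R) (x y : L) :
    omegaN π Ω ![x, y] = Ω ![recursion π Ω x, y] := rfl

end Tensors

/-! ### Cartan calculus of a bracket with anchor -/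

/-- A skew-symmetric bracket on `L` with an anchor, satisfying the Leibniz rule. No Jacobi identity
is required: the bracket deformed by an arbitrary endomorphism is of this kind. -/
structure SkewAlgebroid (R L : Type*) [CommRing R] [Algebra ℝ R] [AddCommGroup L] [Module R L] where
  anchor : L →ₗ[R] Derivation ℝ R R
  bracket : L → L → L
  bracket_add : ∀ x y z, bracket x (y + z) = bracket x y + bracket x z
  bracket_skew : ∀ x y, bracket y x = -bracket x y
  leibniz : ∀ (x : L) (f : R) (y : L), bracket x (f • y) = f • bracket x y + anchor x f • y

namespace SkewAlgebroid

variable {R L : Type*} [CommRing R] [Algebra ℝ R] [AddCommGroup L] [Module R L]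
variable (S : SkewAlgebroid R L)

theorem add_bracket (x y z : L) : S.bracket (x + y) z = S.bracket x z + S.bracket y z := by
  rw [S.bracket_skew z, S.bracket_add, S.bracket_skew x z, S.bracket_skew y z]; abel

theorem smul_bracket (f : R) (x y : L) :
    S.bracket (f • x) y = f • S.bracket x y - S.anchor y f • x := by
  rw [S.bracket_skew y, S.leibniz, S.bracket_skew x y]; module

theorem bracket_neg (x y : L) : S.bracket x (-y) = -S.bracket x y := by
  have h := S.leibniz x (-1) y
  simpa using h

theorem neg_bracket (x y : L) : S.bracket (-x) y = -S.bracket x y := by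
  rw [S.bracket_skew y, S.bracket_neg, S.bracket_skew x y, neg_neg]

/-- The differential of a function: `(df)(x) = ρ(x) f`. -/
def dFun (f : R) : Module.Dual R L where
  toFun x := S.anchor x f
  map_add' x y := by simp
  map_smul' c x := by simp

/-- The Lie derivative of a `1`-form: `(ℒ_x β)(y) = ρ(x)(β(y)) - β([x, y])`. -/
def lieForm (x : L) (β : Module.Dual R L) : Module.Dual R L where
  toFun y := S.anchor x (β y) - β (S.bracket x y)
  map_add' y z := by simp only [map_add, S.bracket_add]; ring
  map_smul' c y := by
    simp only [map_smul, S.leibniz, map_add, smul_eq_mul, Derivation.leibniz, RingHom.id_apply]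
    ring

/-- The exterior differential of a `2`-form, by the Koszul formula. -/
def dTwo (Ω : L [⋀^Fin 2]→ₗ[R] R) : L [⋀^Fin 3]→ₗ[R] R :=
  mkAlt3 (fun x y z =>
      S.anchor x (Ω ![y, z]) - S.anchor y (Ω ![x, z]) + S.anchor z (Ω ![x, y])
        - Ω ![S.bracket x y, z] + Ω ![S.bracket x z, y] - Ω ![S.bracket y z, x])
    (fun x x' y z => by
      simp only [← flat_apply, map_add, S.add_bracket, LinearMap.add_apply,
        Derivation.add_apply]
      ring)
    (fun c x y z => by
      simp only [← flat_apply]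
      simp only [map_smul, S.smul_bracket, LinearMap.smul_apply, map_sub,
        LinearMap.sub_apply, smul_eq_mul, Derivation.leibniz, Derivation.smul_apply]
      ring)
    (fun x y z => by
      rw [S.bracket_skew x y, alt_swap Ω x y]
      simp only [← flat_apply, map_neg, LinearMap.neg_apply]
      ring)
    (fun x y z => by
      rw [S.bracket_skew y z, alt_swap Ω y z]
      simp only [← flat_apply, map_neg, LinearMap.neg_apply]
      ring)

/-- The exterior differential of a `3`-form, by the Koszul formula. -/
def dThree (ψ : L [⋀^Fin 3]→ₗ[R] R) (x y z w : L) : R :=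
  S.anchor x (ψ ![y, z, w]) - S.anchor y (ψ ![x, z, w])
    + S.anchor z (ψ ![x, y, w]) - S.anchor w (ψ ![x, y, z])
    - ψ ![S.bracket x y, z, w] + ψ ![S.bracket x z, y, w] - ψ ![S.bracket x w, y, z]
    - ψ ![S.bracket y z, x, w] + ψ ![S.bracket y w, x, z] - ψ ![S.bracket z w, x, y]

/-- The structure deformed by an endomorphism `N`:
`[x, y]_N = [Nx, y] + [x, Ny] - N[x, y]` with anchor `ρ ∘ N`. -/
def deform (N : Module.End R L) : SkewAlgebroid R L where
  anchor := S.anchor ∘ₗ N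
  bracket x y := S.bracket (N x) y + S.bracket x (N y) - N (S.bracket x y)
  bracket_add x y z := by simp only [map_add, S.bracket_add]; abel
  bracket_skew x y := by
    rw [S.bracket_skew x y, S.bracket_skew x (N y), S.bracket_skew (N x) y, map_neg]; abel
  leibniz x f y := by
    simp only [map_smul, S.leibniz, map_add, LinearMap.comp_apply]
    module

/-- The Nijenhuis torsion `T_N(x, y) = [Nx, Ny] - N([Nx, y] + [x, Ny] - N[x, y])`. -/
def torsion (N : Module.End R L) (x y : L) : L :=
  S.bracket (N x) (N y) - N (S.bracket (N x) y + S.bracket x (N y) - N (S.bracket x y))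

variable [Module.IsReflexive R L]

/-- The Schouten-Nijenhuis bracket of two bivectors, evaluated on three `1`-forms. It is the
extension of the bracket of sections to bivectors by the graded Leibniz rule, see
`schouten_wedge`. -/
def schouten (P Q : Module.Dual R L [⋀^Fin 2]→ₗ[R] R) (α β γ : Module.Dual R L) : R :=
  (α (S.bracket (sharp P β) (sharp Q γ)) + α (S.bracket (sharp Q β) (sharp P γ))
      - S.anchor (sharp P α) (Q ![β, γ]) - S.anchor (sharp Q α) (P ![β, γ]))
  + (β (S.bracket (sharp P γ) (sharp Q α)) + β (S.bracket (sharp Q γ) (sharp P α))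
      - S.anchor (sharp P β) (Q ![γ, α]) - S.anchor (sharp Q β) (P ![γ, α]))
  + (γ (S.bracket (sharp P α) (sharp Q β)) + γ (S.bracket (sharp Q α) (sharp P β))
      - S.anchor (sharp P γ) (Q ![α, β]) - S.anchor (sharp Q γ) (P ![α, β]))

/-- On decomposable bivectors `schouten` is given by the graded Leibniz rule:
`[x ∧ y, z ∧ w] = [x, z] ∧ y ∧ w - [x, w] ∧ y ∧ z - [y, z] ∧ x ∧ w + [y, w] ∧ x ∧ z`. -/
theorem schouten_wedge (x y z w : L) (α β γ : Module.Dual R L) :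
    S.schouten (wedge x y) (wedge z w) α β γ =
      wedge3 (S.bracket x z) y w α β γ - wedge3 (S.bracket x w) y z α β γ
        - wedge3 (S.bracket y z) x w α β γ + wedge3 (S.bracket y w) x z α β γ := by
  have sub_b : ∀ a b c, S.bracket (a - b) c = S.bracket a c - S.bracket b c := fun a b c => by
    rw [sub_eq_add_neg, S.add_bracket, S.neg_bracket, sub_eq_add_neg]
  have b_sub : ∀ a b c, S.bracket a (b - c) = S.bracket a b - S.bracket a c := fun a b c => by
    rw [sub_eq_add_neg, S.bracket_add, S.bracket_neg, sub_eq_add_neg]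
  simp only [schouten, sharp_wedge, wedge_apply, wedge3, sub_b, b_sub, S.smul_bracket, S.leibniz,
    map_sub, map_add, map_smul, smul_eq_mul, Derivation.leibniz,
    Derivation.sub_apply, Derivation.smul_apply, S.bracket_skew x z, S.bracket_skew x w,
    S.bracket_skew y z, S.bracket_skew y w, map_neg, smul_add]
  ring

/-- `π` is a Poisson bivector: `[π, π] = 0` for the Schouten-Nijenhuis bracket. -/
def IsPoisson (π : Module.Dual R L [⋀^Fin 2]→ₗ[R] R) : Prop :=
  ∀ α β γ, S.schouten π π α β γ = 0

/-- The bracket of `1`-forms defined by a bivector: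
`[α, β]_π = ℒ_{π♯α} β - ℒ_{π♯β} α - d(π(α, β))`. -/
def formBracket (π : Module.Dual R L [⋀^Fin 2]→ₗ[R] R) (α β : Module.Dual R L) :
    Module.Dual R L :=
  S.lieForm (sharp π α) β - S.lieForm (sharp π β) α - S.dFun (π ![α, β])

/-- The concomitant `C_{π,N} = ([·,·]_N)_π - ([·,·]_π)_{ᵗN}`: the bracket of `1`-forms defined by
`π` from the `N`-deformed structure, minus the `ᵗN`-deformation of `[·,·]_π`. -/
def concomitant (π : Module.Dual R L [⋀^Fin 2]→ₗ[R] R) (N : Module.End R L)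
    (α β : Module.Dual R L) : Module.Dual R L :=
  (S.deform N).formBracket π α β
    - (S.formBracket π (transp N α) β + S.formBracket π α (transp N β)
        - transp N (S.formBracket π α β))

/-- `(π, N, ψ)` is a Poisson quasi-Nijenhuis structure (without background). The differential
`d_N` is the one of the deformed structure `S.deform N`. -/
structure IsPoissonQuasiNijenhuis (π : Module.Dual R L [⋀^Fin 2]→ₗ[R] R) (N : Module.End R L)
    (ψ : L [⋀^Fin 3]→ₗ[R] R) : Prop where
  poisson : S.IsPoisson π
  comm : N ∘ₗ sharp π = sharp π ∘ₗ transp N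
  concomitant_eq_zero : ∀ α β, S.concomitant π N α β = 0
  torsion_eq : ∀ x y, S.torsion N x y = sharp π (contract₂ ψ x y)
  closed : ∀ x y z w, S.dThree ψ x y z w = 0
  closed_deform : ∀ x y z w, (S.deform N).dThree ψ x y z w = 0

end SkewAlgebroid

/-! ### Sections of a smooth vector bundle -/

section Sections

variable {E : Type*} [NormedAddCommGroup E] [NormedSpace ℝ E]
  {M : Type*} [TopologicalSpace M] [ChartedSpace E M]
  {F : Type*} [NormedAddCommGroup F] [NormedSpace ℝ F]
  {A : M → Type*} [∀ x, AddCommGroup (A x)] [∀ x, Module ℝ (A x)] [∀ x, TopologicalSpace (A x)]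
  [TopologicalSpace (Bundle.TotalSpace F A)] [FiberBundle F A] [VectorBundle ℝ F A]

instance sectionSMul : SMul C^∞⟮𝓘(ℝ, E), M; ℝ⟯ Cₛ^∞⟮𝓘(ℝ, E); F, A⟯ where
  smul f X := ⟨fun x => f x • X x, f.contMDiff.smul_section X.contMDiff⟩

theorem section_smul_apply (f : C^∞⟮𝓘(ℝ, E), M; ℝ⟯) (X : Cₛ^∞⟮𝓘(ℝ, E); F, A⟯) (x : M) :
    (f • X) x = f x • X x := rfl

/-- `Γ(A)` is a module over `C^∞(M)`, pointwise. -/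
instance sectionModule : Module C^∞⟮𝓘(ℝ, E), M; ℝ⟯ Cₛ^∞⟮𝓘(ℝ, E); F, A⟯ where
  one_smul X := by ext x; exact one_smul ℝ (X x)
  mul_smul f g X := by ext x; exact mul_smul (f x) (g x) (X x)
  smul_zero f := by ext x; exact smul_zero (f x)
  smul_add f X Y := by ext x; exact smul_add (f x) (X x) (Y x)
  add_smul f g X := by ext x; exact add_smul (f x) (g x) (X x)
  zero_smul X := by ext x; exact zero_smul ℝ (X x)

variable [FiniteDimensional ℝ E] [IsManifold 𝓘(ℝ, E) ∞ M] [T2Space M]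
  [FiniteDimensional ℝ F] [ContMDiffVectorBundle ∞ F A 𝓘(ℝ, E)]

/-- Near any point, sections are combinations of finitely many global sections `s i`, with
coefficients given by global `1`-forms `a i`. -/
theorem exists_local_dual_basis (x₀ : M) :
    ∃ (n : ℕ) (g : C^∞⟮𝓘(ℝ, E), M; ℝ⟯) (s : Fin n → Cₛ^∞⟮𝓘(ℝ, E); F, A⟯)
      (a : Fin n → Module.Dual C^∞⟮𝓘(ℝ, E), M; ℝ⟯ Cₛ^∞⟮𝓘(ℝ, E); F, A⟯),
      g x₀ = 1 ∧ ∀ X, g • X = ∑ i, a i X • s i := by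
  have : ContMDiffVectorBundle 1 F A 𝓘(ℝ, E) := ContMDiffVectorBundle.of_le (n := ∞) (by simp)
  let e := trivializationAt F A x₀
  have hx₀ : x₀ ∈ e.baseSet := FiberBundle.mem_baseSet_trivializationAt' x₀
  let b := Module.finBasis ℝ F
  obtain ⟨χ, hχ, -⟩ := (SmoothBumpFunction.nhds_basis_support (I := 𝓘(ℝ, E))
    (e.open_baseSet.mem_nhds hx₀)).mem_iff.1 (e.open_baseSet.mem_nhds hx₀)
  let s : Fin (Module.finrank ℝ F) → Cₛ^∞⟮𝓘(ℝ, E); F, A⟯ := fun i =>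
    ⟨(χ : M → ℝ) • e.localFrame b i,
      ContMDiffOn.smul_section_of_tsupport χ.contMDiff.contMDiffOn e.open_baseSet hχ
        (e.contMDiffOn_localFrame_baseSet ∞ b i)⟩
  have hcoef : ∀ (X : Cₛ^∞⟮𝓘(ℝ, E); F, A⟯) i, ContMDiff 𝓘(ℝ, E) 𝓘(ℝ, ℝ) ∞
      (fun x => χ x * e.localFrameCoeff 𝓘(ℝ, E) b i x (X x)) := fun X i => by
    refine contMDiff_of_tsupport fun x hx => ?_
    have hx' : x ∈ e.baseSet := hχ (tsupport_smul_subset_left (χ : M → ℝ) _ hx)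
    exact χ.contMDiff.contMDiffAt.mul
      (contMDiffAt_localFrameCoeff (e := e) b hx' X.contMDiff.contMDiffAt i)
  let a : Fin (Module.finrank ℝ F) →
      Module.Dual C^∞⟮𝓘(ℝ, E), M; ℝ⟯ Cₛ^∞⟮𝓘(ℝ, E); F, A⟯ := fun i =>
    { toFun := fun X => ⟨_, hcoef X i⟩
      map_add' := fun X Y => by
        ext x
        change χ x * e.localFrameCoeff 𝓘(ℝ, E) b i x (X x + Y x) = χ x * _ + χ x * _
        rw [map_add, mul_add]
      map_smul' := fun f X => by
        ext x
        change χ x * e.localFrameCoeff 𝓘(ℝ, E) b i x (f x • X x) = f x * (χ x * _)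
        rw [map_smul, smul_eq_mul]; ring }
  refine ⟨_, ⟨fun x => χ x * χ x, χ.contMDiff.mul χ.contMDiff⟩, s, a, ?_, fun X => ?_⟩
  · change χ x₀ * χ x₀ = 1
    rw [χ.eq_one, one_mul]
  · ext x
    have hsum : (∑ i, a i X • s i) x = ∑ i, (a i X • s i) x := by
      have := map_sum (ContMDiffSection.coeAddHom 𝓘(ℝ, E) F ∞ A) (fun i => a i X • s i) Finset.univ
      have h2 := congrFun this x
      rw [Finset.sum_apply] at h2
      exact h2
    rw [hsum]
    change (χ x * χ x) • X x =
      ∑ i, (χ x * e.localFrameCoeff 𝓘(ℝ, E) b i x (X x)) • (χ x • e.localFrame b i x)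
    by_cases hx : x ∈ e.baseSet
    · have h := e.eq_sum_localFrameCoeff_smul (I := 𝓘(ℝ, E)) (b := b) (s := X) hx
      conv_lhs => rw [h]
      rw [Finset.smul_sum]
      refine Finset.sum_congr rfl fun i _ => ?_
      rw [smul_smul, smul_smul]; congr 1; ring
    · have h0 : χ x = 0 := image_eq_zero_of_notMem_tsupport fun h => hx (hχ h)
      simp [h0]

/-- `Γ(A)` is a reflexive `C^∞(M)`-module. -/
instance sectionReflexive :
    Module.IsReflexive C^∞⟮𝓘(ℝ, E), M; ℝ⟯ Cₛ^∞⟮𝓘(ℝ, E); F, A⟯ where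
  bijective_dual_eval' := by
    have sep : ∀ X Y : Cₛ^∞⟮𝓘(ℝ, E); F, A⟯,
        (∀ β : Module.Dual C^∞⟮𝓘(ℝ, E), M; ℝ⟯ Cₛ^∞⟮𝓘(ℝ, E); F, A⟯, β X = β Y) → X = Y := by
      intro X Y h
      ext x
      obtain ⟨n, g, s, a, hg, hX⟩ := exists_local_dual_basis (E := E) (F := F) (A := A) x
      have h1 : g • X = g • Y := by rw [hX, hX]; simp only [h]
      have h2 : (g • X) x = (g • Y) x := by rw [h1]
      simpa [section_smul_apply, hg] using h2
    refine ⟨fun X Y h => sep X Y fun β => LinearMap.congr_fun h β, fun φ => ?_⟩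
    choose n g s a hg hX using exists_local_dual_basis (E := E) (M := M) (F := F) (A := A)
    let Y : M → Cₛ^∞⟮𝓘(ℝ, E); F, A⟯ := fun x => ∑ i, φ (a x i) • s x i
    have hY : ∀ x β, β (Y x) = g x * φ β := by
      intro x β
      have h1 : ∑ i, β (s x i) • a x i = g x • β := by
        ext X : 1
        have h2 := congrArg β (hX x X)
        simp only [map_smul, map_sum, smul_eq_mul] at h2
        simp only [LinearMap.sum_apply, LinearMap.smul_apply, smul_eq_mul]
        rw [h2]
        exact Finset.sum_congr rfl fun i _ => mul_comm _ _
      have h3 := congrArg φ h1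
      simp only [map_smul, map_sum, smul_eq_mul] at h3
      simp only [Y, map_smul, map_sum, smul_eq_mul]
      rw [← h3]
      exact Finset.sum_congr rfl fun i _ => mul_comm _ _
    have hYY : ∀ x y, g x • Y y = g y • Y x := fun x y => sep _ _ fun β => by
      rw [map_smul, map_smul, hY, hY, smul_eq_mul, smul_eq_mul]; ring
    have key : ∀ x y, g x y • (Y y) y = Y x y := fun x y => by
      have h : (g x • Y y) y = (g y • Y x) y := by rw [hYY]
      simpa [section_smul_apply, hg] using h
    let Z : Cₛ^∞⟮𝓘(ℝ, E); F, A⟯ := ⟨fun x => Y x x, fun x => by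
      have hne : ∀ᶠ y in nhds x, g x y ≠ 0 :=
        (g x).contMDiff.continuous.continuousAt.eventually_ne (by rw [hg]; exact one_ne_zero)
      have hsm := ContMDiffAt.smul_section
        (((g x).contMDiff.contMDiffAt (x := x)).inv₀ (by rw [hg]; exact one_ne_zero))
        ((Y x).contMDiff.contMDiffAt (x := x))
      refine hsm.congr_of_eventuallyEq ?_
      filter_upwards [hne] with y hy
      have : Y y y = (g x y)⁻¹ • Y x y := by
        rw [← key x y, smul_smul, inv_mul_cancel₀ hy, one_smul]
      simp [this]⟩
    have hZ : ∀ x, g x • Z = Y x := fun x => by ext y; exact key x y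
    refine ⟨Z, ?_⟩
    ext β x
    have h1 : g x * β Z = g x * φ β := by rw [← hY, ← hZ, map_smul, smul_eq_mul]
    have h2 : g x x * β Z x = g x x * φ β x := congrArg (fun f : C^∞⟮𝓘(ℝ, E), M; ℝ⟯ => f x) h1
    simpa [hg] using h2

end Sections

/-! ### Lie algebroids -/

/-- A Lie algebroid structure on a smooth vector bundle `A → M`: an anchor `ρ : A → TM`, which is a
smooth morphism of vector bundles over the identity, and a real Lie bracket on `Γ(A)` with
`[X, fY] = f[X, Y] + (ρ(X)f) Y`. -/
structure LieAlgebroid (E : Type*) [NormedAddCommGroup E] [NormedSpace ℝ E]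
    {M : Type*} [TopologicalSpace M] [ChartedSpace E M] [IsManifold 𝓘(ℝ, E) ∞ M]
    (F : Type*) [NormedAddCommGroup F] [NormedSpace ℝ F]
    (A : M → Type*) [∀ x, AddCommGroup (A x)] [∀ x, Module ℝ (A x)] [∀ x, TopologicalSpace (A x)]
    [TopologicalSpace (Bundle.TotalSpace F A)] [FiberBundle F A] [VectorBundle ℝ F A] where
  anchor : ∀ x : M, A x →ₗ[ℝ] TangentSpace 𝓘(ℝ, E) x
  contMDiff_anchor : ContMDiff (𝓘(ℝ, E).prod 𝓘(ℝ, F)) 𝓘(ℝ, E).tangent ∞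
    (fun p : Bundle.TotalSpace F A => (⟨p.1, anchor p.1 p.2⟩ : TangentBundle 𝓘(ℝ, E) M))
  bracket : Cₛ^∞⟮𝓘(ℝ, E); F, A⟯ →ₗ[ℝ] Cₛ^∞⟮𝓘(ℝ, E); F, A⟯ →ₗ[ℝ] Cₛ^∞⟮𝓘(ℝ, E); F, A⟯
  bracket_self : ∀ X, bracket X X = 0
  jacobi : ∀ X Y Z,
    bracket X (bracket Y Z) + bracket Y (bracket Z X) + bracket Z (bracket X Y) = 0
  leibniz : ∀ (X Y : Cₛ^∞⟮𝓘(ℝ, E); F, A⟯) (f : C^∞⟮𝓘(ℝ, E), M; ℝ⟯) (x : M),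
    bracket X (f • Y) x = f x • bracket X Y x + mvfderiv 𝓘(ℝ, E) f x (anchor x (X x)) • Y x

namespace LieAlgebroid

variable {E : Type*} [NormedAddCommGroup E] [NormedSpace ℝ E]
  {M : Type*} [TopologicalSpace M] [ChartedSpace E M] [IsManifold 𝓘(ℝ, E) ∞ M]
  {F : Type*} [NormedAddCommGroup F] [NormedSpace ℝ F]
  {A : M → Type*} [∀ x, AddCommGroup (A x)] [∀ x, Module ℝ (A x)] [∀ x, TopologicalSpace (A x)]
  [TopologicalSpace (Bundle.TotalSpace F A)] [FiberBundle F A] [VectorBundle ℝ F A]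

theorem contMDiff_anchor_apply (𝒜 : LieAlgebroid E F A) (X : Cₛ^∞⟮𝓘(ℝ, E); F, A⟯)
    (f : C^∞⟮𝓘(ℝ, E), M; ℝ⟯) :
    ContMDiff 𝓘(ℝ, E) 𝓘(ℝ, ℝ) ∞
      (fun x => mvfderiv 𝓘(ℝ, E) f x (𝒜.anchor x (X x))) := by
  have h1 : ContMDiff 𝓘(ℝ, E) 𝓘(ℝ, E).tangent ∞
      (fun x => (⟨x, 𝒜.anchor x (X x)⟩ : TangentBundle 𝓘(ℝ, E) M)) :=
    𝒜.contMDiff_anchor.comp X.contMDiff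
  have h2 : ContMDiff 𝓘(ℝ, E).tangent 𝓘(ℝ, ℝ).tangent ∞ (tangentMap 𝓘(ℝ, E) 𝓘(ℝ, ℝ) f) :=
    f.contMDiff.contMDiff_tangentMap (by simp)
  exact (contMDiff_snd_tangentBundle_modelSpace ℝ 𝓘(ℝ, ℝ)).comp (h2.comp h1)

/-- The anchor as a map from sections to derivations: `f ↦ ρ(X) f`. -/
def anchorDer (𝒜 : LieAlgebroid E F A) : Cₛ^∞⟮𝓘(ℝ, E); F, A⟯ →ₗ[C^∞⟮𝓘(ℝ, E), M; ℝ⟯]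
    Derivation ℝ C^∞⟮𝓘(ℝ, E), M; ℝ⟯ C^∞⟮𝓘(ℝ, E), M; ℝ⟯ where
  toFun X := Derivation.mk'
    { toFun := fun f => ⟨_, 𝒜.contMDiff_anchor_apply X f⟩
      map_add' := fun f g => by
        ext x
        have hf := f.contMDiff.mdifferentiableAt (x := x) (by simp)
        have hg := g.contMDiff.mdifferentiableAt (x := x) (by simp)
        exact congrArg (fun T : TangentSpace 𝓘(ℝ, E) x →L[ℝ] ℝ => T (𝒜.anchor x (X x)))
          (mvfderiv_add hf hg)
      map_smul' := fun c f => by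
        ext x
        have hf := f.contMDiff.mdifferentiableAt (x := x) (by simp)
        exact congrArg (fun T : TangentSpace 𝓘(ℝ, E) x →L[ℝ] ℝ => T (𝒜.anchor x (X x)))
          (const_smul_mfderiv hf c) }
    (fun f g => by
      ext x
      have hf := f.contMDiff.mdifferentiableAt (x := x) (by simp)
      have hg := g.contMDiff.mdifferentiableAt (x := x) (by simp)
      exact congrArg (fun T : TangentSpace 𝓘(ℝ, E) x →L[ℝ] ℝ => T (𝒜.anchor x (X x)))
          (mvfderiv_mul hf hg))
  map_add' X Y := by
    ext f x
    change mvfderiv 𝓘(ℝ, E) f x (𝒜.anchor x (X x + Y x)) = _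
    rw [map_add]
    exact map_add (mvfderiv 𝓘(ℝ, E) f x) _ _
  map_smul' c X := by
    ext f x
    change mvfderiv 𝓘(ℝ, E) f x (𝒜.anchor x (c x • X x)) = _
    rw [map_smul]
    exact map_smul (mvfderiv 𝓘(ℝ, E) f x) _ _

/-- The bracket and anchor of a Lie algebroid, on the module of sections. -/
def toSkew (𝒜 : LieAlgebroid E F A) :
    SkewAlgebroid C^∞⟮𝓘(ℝ, E), M; ℝ⟯ Cₛ^∞⟮𝓘(ℝ, E); F, A⟯ where
  anchor := 𝒜.anchorDer
  bracket X Y := 𝒜.bracket X Y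
  bracket_add X Y Z := map_add _ Y Z
  bracket_skew X Y := by
    have h := 𝒜.bracket_self (X + Y)
    simp only [map_add, LinearMap.add_apply, 𝒜.bracket_self, zero_add, add_zero] at h
    exact eq_neg_of_add_eq_zero_left (by rw [← h])
  leibniz X f Y := by
    ext x
    exact 𝒜.leibniz X Y f x

end LieAlgebroid

section TensorFields

variable (E : Type*) [NormedAddCommGroup E] [NormedSpace ℝ E]
  {M : Type*} [TopologicalSpace M] [ChartedSpace E M]
  (F : Type*) [NormedAddCommGroup F] [NormedSpace ℝ F]
  (A : M → Type*) [∀ x, AddCommGroup (A x)] [∀ x, Module ℝ (A x)] [∀ x, TopologicalSpace (A x)]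
  [TopologicalSpace (Bundle.TotalSpace F A)] [FiberBundle F A] [VectorBundle ℝ F A]

/-- `Γ(⋀ᵏ A*)`: alternating `C^∞(M)`-multilinear maps `Γ(A)ᵏ → C^∞(M)`. -/
abbrev AlgebroidForm (k : ℕ) : Type _ :=
  Cₛ^∞⟮𝓘(ℝ, E); F, A⟯ [⋀^Fin k]→ₗ[C^∞⟮𝓘(ℝ, E), M; ℝ⟯] C^∞⟮𝓘(ℝ, E), M; ℝ⟯

/-- `Γ(⋀² A)`: alternating `C^∞(M)`-bilinear maps `Γ(A*) × Γ(A*) → C^∞(M)`, where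
`Γ(A*) = Hom(Γ(A), C^∞(M))`. -/
abbrev AlgebroidBivector : Type _ :=
  Module.Dual C^∞⟮𝓘(ℝ, E), M; ℝ⟯ Cₛ^∞⟮𝓘(ℝ, E); F, A⟯
    [⋀^Fin 2]→ₗ[C^∞⟮𝓘(ℝ, E), M; ℝ⟯] C^∞⟮𝓘(ℝ, E), M; ℝ⟯

end TensorFields

end

/-! Everything follows from Cartan's formula
`ω♭[X, Y] = ℒ_X(ω♭Y) - ℒ_Y(ω♭X) + d(ω(X, Y)) + i_{X ∧ Y} dω`, which needs no Jacobi identity and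
so also holds for the deformed bracket. With `ᵗN = ω♭ ∘ π♯` it turns `C_{π,N}(α, β)` into twice
`ω♭(π♯[α, β]_π - [π♯α, π♯β]) + i_{π♯α ∧ π♯β} dω`, which vanishes because `π` is Poisson, i.e. `π♯`
preserves brackets, and `ω` is closed. Applied to `ω` and `ω_N` it gives
`[ω♭X, ω♭Y]_π = ω♭[X, Y]_N + i_{X ∧ Y} ψ`, and `π♯` of this is the torsion identity. Finally,
Cartan's formula for `d_N ω_N` compares the torsion with `ω(N·, N·)` and yields
`i_N ψ = d(ω(N·, N·))`, so that `d_N ψ = i_N dψ - d i_N ψ = 0`. -/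

section Tensors

variable {R L : Type*} [CommRing R] [AddCommGroup L] [Module R L]

theorem alt_vecCons_sub {L' : Type*} [AddCommGroup L'] [Module R L'] {n : ℕ}
    (ψ : L [⋀^Fin (n + 1)]→ₗ[R] L') (v : Fin n → L) (x y : L) :
    ψ (Matrix.vecCons (x - y) v) = ψ (Matrix.vecCons x v) - ψ (Matrix.vecCons y v) :=
  congrArg (fun φ : L [⋀^Fin n]→ₗ[R] L' => φ v) (map_sub ψ.curryLeft x y)

theorem alt_vecCons_neg {L' : Type*} [AddCommGroup L'] [Module R L'] {n : ℕ}
    (ψ : L [⋀^Fin (n + 1)]→ₗ[R] L') (v : Fin n → L) (x : L) :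
    ψ (Matrix.vecCons (-x) v) = -ψ (Matrix.vecCons x v) :=
  congrArg (fun φ : L [⋀^Fin n]→ₗ[R] L' => φ v) (map_neg ψ.curryLeft x)

theorem alt3_swap_left (ψ : L [⋀^Fin 3]→ₗ[R] R) (x y z : L) : ψ ![y, x, z] = -ψ ![x, y, z] := by
  rw [← ψ.map_swap ![x, y, z] (i := 0) (j := 1) (by decide)]
  congr 1
  funext i; fin_cases i <;> rfl

theorem alt3_swap_right (ψ : L [⋀^Fin 3]→ₗ[R] R) (x y z : L) : ψ ![x, z, y] = -ψ ![x, y, z] := by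
  rw [← ψ.map_swap ![x, y, z] (i := 1) (j := 2) (by decide)]
  congr 1
  funext i; fin_cases i <;> rfl

theorem ext_flat {B C : L [⋀^Fin 2]→ₗ[R] R} (h : ∀ x, flat B x = flat C x) : B = C := by
  ext v
  rw [show v = ![v 0, v 1] by funext i; fin_cases i <;> rfl]
  exact LinearMap.congr_fun (h (v 0)) (v 1)

theorem ext_contract₂ {ψ χ : L [⋀^Fin 3]→ₗ[R] R}
    (h : ∀ x y, contract₂ ψ x y = contract₂ χ x y) : ψ = χ := by
  ext v
  rw [show v = ![v 0, v 1, v 2] by funext i; fin_cases i <;> rfl]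
  exact LinearMap.congr_fun (h (v 1) (v 0)) (v 2)

theorem contract₂_zero (x y : L) : contract₂ (0 : L [⋀^Fin 3]→ₗ[R] R) x y = 0 := rfl

theorem contract₂_neg (ψ : L [⋀^Fin 3]→ₗ[R] R) (x y : L) :
    contract₂ (-ψ) x y = -contract₂ ψ x y := rfl

theorem flat_compLinearMap (Ω : L [⋀^Fin 2]→ₗ[R] R) (N : Module.End R L) (x : L) :
    flat (Ω.compLinearMap N) x = transp N (flat Ω (N x)) := by
  ext y
  rw [flat_apply, transp_apply, flat_apply, AlternatingMap.compLinearMap_apply]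
  congr 1
  funext i; fin_cases i <;> rfl

/-- The insertion `i_N Ω` of an endomorphism into a `2`-form. -/
def insertTwo (N : Module.End R L) (Ω : L [⋀^Fin 2]→ₗ[R] R) : L [⋀^Fin 2]→ₗ[R] R :=
  mkAlt2 (flat Ω ∘ₗ N + transp N ∘ₗ flat Ω) fun x => by
    simp only [LinearMap.add_apply, LinearMap.comp_apply, transp_apply, flat_apply]
    rw [alt_swap Ω x (N x), neg_add_cancel]

theorem insertTwo_apply (N : Module.End R L) (Ω : L [⋀^Fin 2]→ₗ[R] R) (x y : L) :
    insertTwo N Ω ![x, y] = Ω ![N x, y] + Ω ![x, N y] := rfl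

/-- The insertion `i_N ψ` of an endomorphism into a `3`-form. -/
def insertThree [Algebra ℝ R] (N : Module.End R L) (ψ : L [⋀^Fin 3]→ₗ[R] R) :
    L [⋀^Fin 3]→ₗ[R] R :=
  mkAlt3 (fun x y z => ψ ![N x, y, z] + ψ ![x, N y, z] + ψ ![x, y, N z])
    (fun x x' y z => by
      simp only [map_add, AlternatingMap.map_vecCons_add]
      ring)
    (fun c x y z => by
      simp only [map_smul, AlternatingMap.map_vecCons_smul, smul_eq_mul]
      ring)
    (fun x y z => by
      rw [alt3_swap_left ψ (N x) y, alt3_swap_left ψ x (N y), alt3_swap_left ψ x y]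
      ring)
    (fun x y z => by
      rw [alt3_swap_right ψ (N x) y, alt3_swap_right ψ x (N y), alt3_swap_right ψ x y]
      ring)

theorem insertThree_apply [Algebra ℝ R] (N : Module.End R L) (ψ : L [⋀^Fin 3]→ₗ[R] R)
    (x y z : L) :
    insertThree N ψ ![x, y, z] = ψ ![N x, y, z] + ψ ![x, N y, z] + ψ ![x, y, N z] := rfl

variable [Module.IsReflexive R L]
variable (π : Module.Dual R L [⋀^Fin 2]→ₗ[R] R) (Ω : L [⋀^Fin 2]→ₗ[R] R)

theorem apply_sharp_swap (α β : Module.Dual R L) : β (sharp π α) = -α (sharp π β) := by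
  rw [apply_sharp, apply_sharp, alt_swap]

theorem transp_recursion : transp (recursion π Ω) = flat Ω ∘ₗ sharp π := by
  ext α x
  calc α (sharp π (flat Ω x)) = -Ω ![x, sharp π α] := apply_sharp_swap π (flat Ω x) α
    _ = Ω ![sharp π α, x] := (alt_swap Ω x (sharp π α)).symm

theorem recursion_comp_sharp :
    recursion π Ω ∘ₗ sharp π = sharp π ∘ₗ transp (recursion π Ω) := by
  rw [transp_recursion, recursion, LinearMap.comp_assoc]

theorem flat_omegaN (x : L) : flat (omegaN π Ω) x = flat Ω (recursion π Ω x) := rfl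

theorem flat_recursion (x : L) : flat Ω (recursion π Ω x) = transp (recursion π Ω) (flat Ω x) := by
  rw [transp_recursion]
  rfl

theorem insertTwo_omegaN :
    insertTwo (recursion π Ω) (omegaN π Ω) =
      Ω.compLinearMap (recursion π Ω) + Ω.compLinearMap (recursion π Ω) := by
  refine ext_flat fun x => ?_
  change flat (omegaN π Ω) (recursion π Ω x) + transp (recursion π Ω) (flat (omegaN π Ω) x) =
    flat (Ω.compLinearMap (recursion π Ω)) x + flat (Ω.compLinearMap (recursion π Ω)) x
  rw [flat_compLinearMap, flat_omegaN, flat_omegaN, flat_recursion]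

end Tensors

namespace SkewAlgebroid

section Cartan

variable {R L : Type*} [CommRing R] [Algebra ℝ R] [AddCommGroup L] [Module R L]
variable (S : SkewAlgebroid R L)

theorem lieForm_apply (x : L) (β : Module.Dual R L) (y : L) :
    S.lieForm x β y = S.anchor x (β y) - β (S.bracket x y) := rfl

theorem dFun_apply (f : R) (x : L) : S.dFun f x = S.anchor x f := rfl

theorem dFun_add (f g : R) : S.dFun (f + g) = S.dFun f + S.dFun g := by
  ext x
  exact map_add (S.anchor x) f g

theorem dFun_neg (f : R) : S.dFun (-f) = -S.dFun f := by
  ext x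
  exact map_neg (S.anchor x) f

theorem dTwo_apply (Ω : L [⋀^Fin 2]→ₗ[R] R) (x y z : L) :
    S.dTwo Ω ![x, y, z] =
      S.anchor x (Ω ![y, z]) - S.anchor y (Ω ![x, z]) + S.anchor z (Ω ![x, y])
        - Ω ![S.bracket x y, z] + Ω ![S.bracket x z, y] - Ω ![S.bracket y z, x] := rfl

theorem flat_bracket (Ω : L [⋀^Fin 2]→ₗ[R] R) (x y : L) :
    flat Ω (S.bracket x y) = S.lieForm x (flat Ω y) - S.lieForm y (flat Ω x)
      + S.dFun (Ω ![x, y]) + contract₂ (S.dTwo Ω) x y := by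
  ext z
  simp only [LinearMap.add_apply, LinearMap.sub_apply, flat_apply, lieForm_apply, dFun_apply,
    contract₂_apply, dTwo_apply]
  rw [alt_swap Ω x y, S.bracket_skew x y, alt_swap Ω (S.bracket x z) y,
    alt_swap Ω (S.bracket y z) x, alt_vecCons_neg, map_neg]
  ring

variable (N : Module.End R L)

theorem deform_bracket (x y : L) : (S.deform N).bracket x y =
    S.bracket (N x) y + S.bracket x (N y) - N (S.bracket x y) := rfl

theorem dFun_deform (f : R) : (S.deform N).dFun f = transp N (S.dFun f) := rfl

theorem lieForm_deform (x : L) (β : Module.Dual R L) :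
    (S.deform N).lieForm x β =
      S.lieForm (N x) β - S.lieForm x (transp N β) + transp N (S.lieForm x β) := by
  ext y
  simp only [lieForm_apply, deform, LinearMap.comp_apply, LinearMap.add_apply,
    LinearMap.sub_apply, transp_apply, map_add, map_sub]
  ring

theorem dTwo_add (Ω Ω' : L [⋀^Fin 2]→ₗ[R] R) : S.dTwo (Ω + Ω') = S.dTwo Ω + S.dTwo Ω' := by
  refine ext_contract₂ fun x y => LinearMap.ext fun z => ?_
  simp only [contract₂_apply, AlternatingMap.add_apply, dTwo_apply, map_add]
  ring

theorem dTwo_deform (Ω : L [⋀^Fin 2]→ₗ[R] R) :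
    (S.deform N).dTwo Ω = insertThree N (S.dTwo Ω) - S.dTwo (insertTwo N Ω) := by
  refine ext_contract₂ fun x y => LinearMap.ext fun z => ?_
  simp only [contract₂_apply, AlternatingMap.sub_apply, insertThree_apply, insertTwo_apply,
    dTwo_apply, deform, LinearMap.comp_apply, map_add, AlternatingMap.map_vecCons_add,
    alt_vecCons_sub]
  ring

theorem dThree_deform (ψ : L [⋀^Fin 3]→ₗ[R] R) (x y z w : L) :
    (S.deform N).dThree ψ x y z w =
      S.dThree ψ (N x) y z w + S.dThree ψ x (N y) z w + S.dThree ψ x y (N z) w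
        + S.dThree ψ x y z (N w) - S.dThree (insertThree N ψ) x y z w := by
  simp only [dThree, deform, LinearMap.comp_apply, insertThree_apply, map_add,
    AlternatingMap.map_vecCons_add, alt_vecCons_sub]
  ring

theorem flat_torsion {Ω ΩN : L [⋀^Fin 2]→ₗ[R] R} (hΩN : ∀ x, flat ΩN x = flat Ω (N x)) (x y : L) :
    flat Ω (S.torsion N x y) =
      contract₂ (S.dTwo Ω) (N x) (N y) + transp N (contract₂ (S.dTwo ΩN) x y)
        - contract₂ (S.dTwo (Ω.compLinearMap N)) x y
        - contract₂ ((S.deform N).dTwo ΩN) x y := by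
  have hflat : ∀ v, flat (Ω.compLinearMap N) v = transp N (flat ΩN v) := fun v => by
    rw [flat_compLinearMap, hΩN]
  have hval : Ω.compLinearMap N ![x, y] = Ω ![N x, N y] := by
    rw [← flat_apply, flat_compLinearMap, transp_apply, flat_apply]
  have cartan_N := S.flat_bracket Ω (N x) (N y)
  have cartan_comp := S.flat_bracket (Ω.compLinearMap N) x y
  have cartan_transp := congrArg (transp N) (S.flat_bracket ΩN x y)
  have cartan_deform := (S.deform N).flat_bracket ΩN x y
  rw [hval] at cartan_comp
  simp only [hflat, ← hΩN, map_add, map_sub, lieForm_deform, dFun_deform]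
    at cartan_N cartan_comp cartan_transp cartan_deform
  rw [torsion, map_sub, ← hΩN, ← deform_bracket, cartan_N, cartan_deform]
  linear_combination (norm := module) cartan_transp - cartan_comp

end Cartan

section LieRinehart

variable {R L : Type*} [CommRing R] [Algebra ℝ R] [AddCommGroup L] [Module R L]
variable {S : SkewAlgebroid R L}

/-- The bracket and the anchor make `L` a Lie-Rinehart algebra: the Jacobi identity holds, and the
anchor is a morphism of Lie algebras. -/
structure IsLieRinehart (S : SkewAlgebroid R L) : Prop where
  jacobi : ∀ x y z,
    S.bracket (S.bracket x y) z = S.bracket x (S.bracket y z) - S.bracket y (S.bracket x z)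
  anchor_bracket : ∀ x y, S.anchor (S.bracket x y) = ⁅S.anchor x, S.anchor y⁆

theorem IsLieRinehart.dThree_dTwo (hS : S.IsLieRinehart) (Ω : L [⋀^Fin 2]→ₗ[R] R) (x y z w : L) :
    S.dThree (S.dTwo Ω) x y z w = 0 := by
  have jacobi (x y z w : L) : Ω ![S.bracket (S.bracket x y) z, w]
      + Ω ![S.bracket (S.bracket y z) x, w] - Ω ![S.bracket (S.bracket x z) y, w] = 0 := by
    rw [hS.jacobi, S.bracket_skew x (S.bracket y z), S.bracket_skew y (S.bracket x z)]
    simp only [alt_vecCons_sub, alt_vecCons_neg]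
    ring
  simp only [dThree, dTwo_apply, map_add, map_sub, hS.anchor_bracket,
    Derivation.commutator_apply]
  rw [alt_swap Ω (S.bracket x y) (S.bracket z w), alt_swap Ω (S.bracket x z) (S.bracket y w),
    alt_swap Ω (S.bracket x w) (S.bracket y z)]
  linear_combination jacobi x y z w - jacobi x y w z + jacobi x z w y - jacobi y z w x

theorem anchor_bracket_smul {x y : L} (jacobi : ∀ z,
      S.bracket (S.bracket x y) z = S.bracket x (S.bracket y z) - S.bracket y (S.bracket x z))
    (f : R) (z : L) : S.anchor (S.bracket x y) f • z = ⁅S.anchor x, S.anchor y⁆ f • z := by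
  have h := jacobi (f • z)
  simp only [S.leibniz, S.bracket_add, jacobi z] at h
  rw [Derivation.commutator_apply]
  linear_combination (norm := module) h

end LieRinehart

section Poisson

variable {R L : Type*} [CommRing R] [Algebra ℝ R] [AddCommGroup L] [Module R L]
  [Module.IsReflexive R L]
variable (S : SkewAlgebroid R L)

theorem schouten_self (π : Module.Dual R L [⋀^Fin 2]→ₗ[R] R) (α β γ : Module.Dual R L) :
    S.schouten π π α β γ =
      2 * (γ (S.bracket (sharp π α) (sharp π β)) - γ (sharp π (S.formBracket π α β))) := by
  rw [apply_sharp_swap, schouten, formBracket, S.bracket_skew (sharp π α) (sharp π γ),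
    alt_swap π α γ]
  simp only [LinearMap.sub_apply, lieForm_apply, dFun_apply, map_neg]
  simp only [apply_sharp]
  rw [alt_swap π α γ, alt_swap π β γ]
  simp only [map_neg]
  ring

variable {S}

theorem isPoisson_iff_sharp_formBracket {π : Module.Dual R L [⋀^Fin 2]→ₗ[R] R} :
    S.IsPoisson π ↔
      ∀ α β, sharp π (S.formBracket π α β) = S.bracket (sharp π α) (sharp π β) := by
  refine ⟨fun hπ α β => (Module.evalEquiv R L).injective (LinearMap.ext fun γ => ?_),
    fun h α β γ => by rw [schouten_self, h, sub_self, mul_zero]⟩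
  have h : (2 : ℝ) • (γ (S.bracket (sharp π α) (sharp π β))
      - γ (sharp π (S.formBracket π α β))) = 0 := by
    rw [ofNat_smul_eq_nsmul, nsmul_eq_mul, Nat.cast_ofNat, ← schouten_self, hπ]
  exact (sub_eq_zero.1 ((smul_eq_zero_iff_right two_ne_zero).1 h)).symm

theorem concomitant_eq {π : Module.Dual R L [⋀^Fin 2]→ₗ[R] R} {N : Module.End R L}
    (hN : N ∘ₗ sharp π = sharp π ∘ₗ transp N) (α β : Module.Dual R L) :
    S.concomitant π N α β =
      2 • (transp N (S.formBracket π α β) - S.lieForm (sharp π α) (transp N β)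
        + S.lieForm (sharp π β) (transp N α))
      + S.dFun (π ![transp N α, β] + π ![α, transp N β]) := by
  have hN' : ∀ γ, N (sharp π γ) = sharp π (transp N γ) := LinearMap.congr_fun hN
  simp only [concomitant, formBracket, lieForm_deform, dFun_deform, hN', dFun_add, map_sub]
  module

variable (π : Module.Dual R L [⋀^Fin 2]→ₗ[R] R) (Ω : L [⋀^Fin 2]→ₗ[R] R)

theorem concomitant_recursion (α β : Module.Dual R L) :
    S.concomitant π (recursion π Ω) α β =
      2 • (flat Ω (sharp π (S.formBracket π α β) - S.bracket (sharp π α) (sharp π β))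
        + contract₂ (S.dTwo Ω) (sharp π α) (sharp π β)) := by
  have hα : π ![flat Ω (sharp π α), β] = -Ω ![sharp π α, sharp π β] := by
    rw [alt_swap, ← apply_sharp, flat_apply]
  have hβ : π ![α, flat Ω (sharp π β)] = -Ω ![sharp π α, sharp π β] := by
    rw [← apply_sharp, flat_apply, alt_swap]
  rw [concomitant_eq (recursion_comp_sharp π Ω), transp_recursion]
  simp only [LinearMap.comp_apply, hα, hβ, dFun_add, dFun_neg, map_sub, S.flat_bracket]
  module

theorem formBracket_flat (x y : L) :
    S.formBracket π (flat Ω x) (flat Ω y) =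
      flat Ω ((S.deform (recursion π Ω)).bracket x y) + contract₂ (S.dTwo (omegaN π Ω)) x y
        - contract₂ (S.dTwo Ω) (recursion π Ω x) y
        - contract₂ (S.dTwo Ω) x (recursion π Ω y) := by
  have hflat : π ![flat Ω x, flat Ω y] = -Ω ![recursion π Ω x, y] := by
    rw [← apply_sharp, flat_apply, alt_swap]
    rfl
  have hsymm : Ω ![x, recursion π Ω y] = Ω ![recursion π Ω x, y] := by
    rw [← flat_apply, ← transp_apply, ← flat_recursion, flat_apply]
  have cartan_omegaN := S.flat_bracket (omegaN π Ω) x y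
  simp only [flat_omegaN, omegaN_apply] at cartan_omegaN
  rw [deform_bracket, map_sub, map_add, cartan_omegaN, S.flat_bracket Ω (recursion π Ω x),
    S.flat_bracket Ω x, hsymm, formBracket, hflat, dFun_neg]
  simp only [recursion, LinearMap.comp_apply]
  module

variable {π Ω}

theorem IsPoisson.concomitant_recursion_eq_zero (hπ : S.IsPoisson π) (hΩ : S.dTwo Ω = 0)
    (α β : Module.Dual R L) : S.concomitant π (recursion π Ω) α β = 0 := by
  rw [concomitant_recursion, isPoisson_iff_sharp_formBracket.1 hπ, sub_self, map_zero, hΩ,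
    contract₂_zero, add_zero, smul_zero]

theorem IsPoisson.torsion_recursion (hπ : S.IsPoisson π) (hΩ : S.dTwo Ω = 0) (x y : L) :
    S.torsion (recursion π Ω) x y = sharp π (contract₂ (S.dTwo (omegaN π Ω)) x y) := by
  have h := congrArg (sharp π) (S.formBracket_flat π Ω x y)
  rw [hΩ, contract₂_zero, contract₂_zero, sub_zero, sub_zero,
    isPoisson_iff_sharp_formBracket.1 hπ, map_add] at h
  exact sub_eq_of_eq_add' h

theorem IsPoisson.insertThree_dTwo_omegaN (hπ : S.IsPoisson π) (hΩ : S.dTwo Ω = 0) :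
    insertThree (recursion π Ω) (S.dTwo (omegaN π Ω)) =
      S.dTwo (Ω.compLinearMap (recursion π Ω)) := by
  have hdeform : (S.deform (recursion π Ω)).dTwo (omegaN π Ω) =
      -S.dTwo (Ω.compLinearMap (recursion π Ω)) := by
    refine ext_contract₂ fun x y => ?_
    have h := S.flat_torsion (recursion π Ω) (flat_omegaN π Ω) x y
    rw [hπ.torsion_recursion hΩ, hΩ, contract₂_zero, zero_add, transp_recursion,
      LinearMap.comp_apply] at h
    rw [contract₂_neg]
    linear_combination (norm := module) h
  rw [dTwo_deform, insertTwo_omegaN, dTwo_add] at hdeform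
  linear_combination (norm := module) hdeform

end Poisson

end SkewAlgebroid

namespace LieAlgebroid

variable {E : Type*} [NormedAddCommGroup E] [NormedSpace ℝ E]
  {M : Type*} [TopologicalSpace M] [ChartedSpace E M] [IsManifold 𝓘(ℝ, E) ∞ M]
  {F : Type*} [NormedAddCommGroup F] [NormedSpace ℝ F]
  {A : M → Type*} [∀ x, AddCommGroup (A x)] [∀ x, Module ℝ (A x)] [∀ x, TopologicalSpace (A x)]
  [TopologicalSpace (Bundle.TotalSpace F A)] [FiberBundle F A] [VectorBundle ℝ F A]
  (𝒜 : LieAlgebroid E F A)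

theorem toSkew_jacobi (X Y Z : Cₛ^∞⟮𝓘(ℝ, E); F, A⟯) :
    𝒜.toSkew.bracket (𝒜.toSkew.bracket X Y) Z =
      𝒜.toSkew.bracket X (𝒜.toSkew.bracket Y Z) - 𝒜.toSkew.bracket Y (𝒜.toSkew.bracket X Z) := by
  rw [𝒜.toSkew.bracket_skew Z, 𝒜.toSkew.bracket_skew Z X, 𝒜.toSkew.bracket_neg, sub_neg_eq_add,
    neg_eq_iff_add_eq_zero, add_comm]
  exact 𝒜.jacobi X Y Z

theorem toSkew_anchor_apply_eq_zero {X : Cₛ^∞⟮𝓘(ℝ, E); F, A⟯} {x : M} (hX : X x = 0)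
    (f : C^∞⟮𝓘(ℝ, E), M; ℝ⟯) : 𝒜.toSkew.anchor X f x = 0 := by
  change mvfderiv 𝓘(ℝ, E) f x (𝒜.anchor x (X x)) = 0
  rw [hX, map_zero]
  exact map_zero (mvfderiv 𝓘(ℝ, E) f x)

theorem toSkew_anchor_bracket (X Y : Cₛ^∞⟮𝓘(ℝ, E); F, A⟯) :
    𝒜.toSkew.anchor (𝒜.toSkew.bracket X Y) = ⁅𝒜.toSkew.anchor X, 𝒜.toSkew.anchor Y⁆ := by
  ext f x
  -- Where all sections vanish the anchor vanishes too; elsewhere a nonzero value can be cancelled.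
  by_cases hx : ∀ Z : Cₛ^∞⟮𝓘(ℝ, E); F, A⟯, Z x = 0
  · rw [Derivation.commutator_apply, 𝒜.toSkew_anchor_apply_eq_zero (hx _)]
    change 0 = 𝒜.toSkew.anchor X _ x - 𝒜.toSkew.anchor Y _ x
    rw [𝒜.toSkew_anchor_apply_eq_zero (hx X), 𝒜.toSkew_anchor_apply_eq_zero (hx Y), sub_zero]
  · push Not at hx
    obtain ⟨Z, hZ⟩ := hx
    have h := SkewAlgebroid.anchor_bracket_smul (𝒜.toSkew_jacobi X Y) f Z
    exact smul_left_injective ℝ hZ (congrArg (fun W : Cₛ^∞⟮𝓘(ℝ, E); F, A⟯ => W x) h)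

theorem isLieRinehart_toSkew : 𝒜.toSkew.IsLieRinehart :=
  ⟨𝒜.toSkew_jacobi, 𝒜.toSkew_anchor_bracket⟩

end LieAlgebroid

theorem mainTheorem9_general {R L : Type*} [CommRing R] [Algebra ℝ R] [AddCommGroup L] [Module R L]
    [Module.IsReflexive R L] {S : SkewAlgebroid R L} (hS : S.IsLieRinehart)
    {π : Module.Dual R L [⋀^Fin 2]→ₗ[R] R} (hπ : S.IsPoisson π)
    {Ω : L [⋀^Fin 2]→ₗ[R] R} (hΩ : S.dTwo Ω = 0) :
    S.IsPoissonQuasiNijenhuis π (recursion π Ω) (S.dTwo (omegaN π Ω)) where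
  poisson := hπ
  comm := recursion_comp_sharp π Ω
  concomitant_eq_zero := hπ.concomitant_recursion_eq_zero hΩ
  torsion_eq := hπ.torsion_recursion hΩ
  closed := hS.dThree_dTwo _
  closed_deform x y z w := by
    rw [S.dThree_deform, hπ.insertThree_dTwo_omegaN hΩ]
    simp only [hS.dThree_dTwo, add_zero, sub_zero]

theorem mainTheorem9
    {E : Type*} [NormedAddCommGroup E] [NormedSpace ℝ E] [FiniteDimensional ℝ E]
    {M : Type*} [TopologicalSpace M] [T2Space M] [ChartedSpace E M] [IsManifold 𝓘(ℝ, E) ∞ M]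
    {F : Type*} [NormedAddCommGroup F] [NormedSpace ℝ F] [FiniteDimensional ℝ F]
    {A : M → Type*} [∀ x, AddCommGroup (A x)] [∀ x, Module ℝ (A x)] [∀ x, TopologicalSpace (A x)]
    [TopologicalSpace (Bundle.TotalSpace F A)] [FiberBundle F A] [VectorBundle ℝ F A]
    [ContMDiffVectorBundle ∞ F A 𝓘(ℝ, E)]
    (𝒜 : LieAlgebroid E F A)
    (π : AlgebroidBivector E F A) (hπ : 𝒜.toSkew.IsPoisson π)
    (Ω : AlgebroidForm E F A 2) (hΩ : 𝒜.toSkew.dTwo Ω = 0) :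
    𝒜.toSkew.IsPoissonQuasiNijenhuis π (recursion π Ω) (𝒜.toSkew.dTwo (omegaN π Ω)) :=
  mainTheorem9_general 𝒜.isLieRinehart_toSkew hπ hΩ
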